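/- Let $0<q<1$. Write $(a;q)_m=\prod_{j=0}^{m-1}(1-aq^j)$ and let $$\tilde p_n(x;\alpha,\beta|q)=(-1)^nq^{\binom n2}\frac{(\alpha q;q)_n}{(\alpha\beta q^{n+1};q)_n}\sum_{i=0}^{n}\frac{(q^{-n};q)_i(\alpha\beta q^{n+1};q)_i}{(\alpha q;q)_i}\,\frac{(qx)^i}{(q;q)_i}$$ be the monic little $q$-Jacobi polynomials. Let $w(i)=\frac{(\beta q;q)_i(\alpha q)^i}{(q;q)_i}$, $i=0,1,2,\dots$, be the discrete weight with (positive) mass $w(i)$ at the point $q^i$. A polynomial $Q$ of exact degree $n\ge r$ is called quasi-orthogonal of order $r$ with respect to $w$ on $(0,1)$ if the series $\sum_{i=0}^{\infty}(q^i)^jQ(q^i)w(i)$ converges for $0\le j\le n-r$, has sum $0$ for $0\le j\le n-r-1$, and has non-zero sum for $j=n-r$. Theorem 2.9. Let $k,m\in\mathbb N_0$ and let $\alpha,\beta\in\mathbb R$ with $0<\alpha q<1$ and $0<\beta q<1$. In all three parts $w$ is the weight with the unshifted parameters $\alpha,\beta$. (i) If $\alpha>1$, then for every $n\ge k+1$ the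 polynomial $\tilde p_n(x;\frac{\alpha}{q^k},\beta|q)$ is quasi-orthogonal of order $k$ with respect to $w$ on $(0,1)$, and it has at least $n-k$ real distinct zeros in $(0,1)$. (ii) If $\beta>1$, then for every $n\ge m+1$ the polynomial $\tilde p_n(x;\alpha,\frac{\beta}{q^m}|q)$ is quasi-orthogonal of order $m$ with respect to $w$ on $(0,1)$, and it has at least $n-m$ real distinct zeros in $(0,1)$. (iii) If $\alpha>1$ and $\beta>1$, then for every $n\ge k+m+1$ the polynomial $\tilde p_n(x;\frac{\alpha}{q^k},\frac{\beta}{q^m}|q)$ is quasi-orthogonal of order $k+m$ with respect to $w$ on $(0,1)$, and it has at least $n-(k+m)$ real distinct zeros in $(0,1)$. -/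

import Mathlib

/-- The `q`-shifted factorial `(a; q)_m = ∏_{j=0}^{m-1} (1 - a q^j)`. -/
noncomputable def qPochhammer (a q : ℝ) (m : ℕ) : ℝ :=
  ∏ j ∈ Finset.range m, (1 - a * q ^ j)

/-- The basic hypergeometric series `₂φ₁(a, b; c; q; z)`. -/
noncomputable def qHypergeometric21 (a b c q z : ℝ) : ℝ :=
  ∑' i : ℕ, qPochhammer a q i * qPochhammer b q i / qPochhammer c q i *
    (z ^ i / qPochhammer q q i)

/-- The monic little `q`-Jacobi polynomial
`p̃_n(x; α, β | q) = (-1)^n q^{n(n-1)/2} (αq; q)_n / (αβq^{n+1}; q)_n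
  · ₂φ₁(q^{-n}, αβq^{n+1}; αq; q; qx)`.
The series is written as the sum of its terms of index at most `n`; the others vanish
(see `littleQJacobi_eval`). -/
noncomputable def littleQJacobi (n : ℕ) (α β q : ℝ) : Polynomial ℝ :=
  Polynomial.C ((-1) ^ n * q ^ n.choose 2 *
      (qPochhammer (α * q) q n / qPochhammer (α * β * q ^ (n + 1)) q n)) *
    ∑ i ∈ Finset.range (n + 1),
      Polynomial.C (qPochhammer (q ^ n)⁻¹ q i * qPochhammer (α * β * q ^ (n + 1)) q i /
          qPochhammer (α * q) q i / qPochhammer q q i) *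
        (Polynomial.C q * Polynomial.X) ^ i

theorem qPochhammer_inv_pow_eq_zero {q : ℝ} (hq : q ≠ 0) {n i : ℕ} (h : n < i) :
    qPochhammer (q ^ n)⁻¹ q i = 0 := by
  unfold qPochhammer
  refine Finset.prod_eq_zero (Finset.mem_range.mpr h) ?_
  rw [inv_mul_cancel₀ (pow_ne_zero n hq), sub_self]

/-- The values of `littleQJacobi` are given by the `₂φ₁` series. -/
theorem littleQJacobi_eval {q : ℝ} (hq : q ≠ 0) (n : ℕ) (α β x : ℝ) :
    (littleQJacobi n α β q).eval x =
      (-1) ^ n * q ^ n.choose 2 *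
        (qPochhammer (α * q) q n / qPochhammer (α * β * q ^ (n + 1)) q n) *
      qHypergeometric21 (q ^ n)⁻¹ (α * β * q ^ (n + 1)) (α * q) q (q * x) := by
  unfold qHypergeometric21
  rw [tsum_eq_sum (s := Finset.range (n + 1))]
  · simp only [littleQJacobi, Polynomial.eval_mul, Polynomial.eval_C, Polynomial.eval_finsetSum,
      Polynomial.eval_pow, Polynomial.eval_X]
    congr 1
    refine Finset.sum_congr rfl fun i _ => ?_
    ring
  · intro i hi
    rw [qPochhammer_inv_pow_eq_zero hq (by simpa using hi)]
    simp

/-- The weight `w(i) = (βq; q)_i (αq)^i / (q; q)_i`, placed at the point `q^i`, for which the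
little `q`-Jacobi polynomials are orthogonal. -/
noncomputable def littleQJacobiWeight (α β q : ℝ) (i : ℕ) : ℝ :=
  qPochhammer (β * q) q i * (α * q) ^ i / qPochhammer q q i

/-- `Q` is a polynomial of exact degree `n ≥ k` that is quasi-orthogonal of order `k` on the
interval with end points `a` and `b`, with respect to the discrete weight that has the positive
mass `w i` at the point `x i`, `i = 0, 1, 2, …`: the moments `∑ i, (x i)^m Q(x i) w i` (which
converge) vanish for `m = 0, …, n - k - 1`, and the moment for `m = n - k` does not vanish. -/
structure IsDiscreteQuasiOrthogonal (a b : ℝ) (x w : ℕ → ℝ) (n k : ℕ) (Q : Polynomial ℝ) :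
    Prop where
  mem_Icc : ∀ i, x i ∈ Set.Icc a b
  weight_pos : ∀ i, 0 < w i
  le : k ≤ n
  degree_eq : Q.degree = n
  moment_eq_zero : ∀ m : ℕ, m + k < n → HasSum (fun i => x i ^ m * Q.eval (x i) * w i) 0
  moment_ne_zero : ∃ s : ℝ, s ≠ 0 ∧ HasSum (fun i => x i ^ (n - k) * Q.eval (x i) * w i) s

/-- `Q` has at least `r` distinct real zeros in the open interval `(a, b)`. -/
def HasAtLeastZerosIn (a b : ℝ) (r : ℕ) (Q : Polynomial ℝ) : Prop :=
  ∃ S : Finset ℝ, r ≤ S.card ∧ ∀ y ∈ S, y ∈ Set.Ioo a b ∧ Q.eval y = 0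

/-!
The weight absorbs powers of its nodes: `(q ^ i) ^ j * w(i; α, β) = w(i; α q ^ j, β)`. Hence every
moment of a polynomial against `w` is an integral against a shifted weight, and
`∑ i, w(i; α q ^ t, β) = (αq; q)_t / (αβq²; q)_t * ∑ i, w(i; α, β)` by the functional equation of
the `q`-binomial series.

On the other hand `(q⁻ⁿ; q)_t q ^ t / (q; q)_t` is, up to the factor `(q; q)_n`, the Lagrange
weight of the node `q ^ t` among `1, q, …, qⁿ`. Consequently the integral of `p̃_n(x; a, b)` against
the weight with parameters `a q ^ k`, `b q ^ m` is a multiple of the divided difference at these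
nodes of `y ↦ (a q y; q)_k (a b q ^ (k + m + 2) y; q)_∞ / (a b q ^ (n + 1) y; q)_∞`. For `k + m < n`
this is a polynomial of degree less than `n`, so the divided difference vanishes; for `k + m = n` it
is a polynomial over a linear factor, and the divided difference is, up to a non-zero factor, the
value of that polynomial at the pole.
-/

open Polynomial

section QPochhammer

variable {a q : ℝ}

theorem qPochhammer_zero (a q : ℝ) : qPochhammer a q 0 = 1 :=
  Finset.prod_range_zero _

theorem qPochhammer_succ (a q : ℝ) (m : ℕ) :
    qPochhammer a q (m + 1) = qPochhammer a q m * (1 - a * q ^ m) :=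
  Finset.prod_range_succ _ m

theorem qPochhammer_add (a q : ℝ) (m n : ℕ) :
    qPochhammer a q (m + n) = qPochhammer a q m * qPochhammer (a * q ^ m) q n := by
  simp only [qPochhammer, Finset.prod_range_add, pow_add, mul_assoc]

theorem qPochhammer_ne_zero {m : ℕ} (h : ∀ j < m, a * q ^ j ≠ 1) : qPochhammer a q m ≠ 0 :=
  Finset.prod_ne_zero_iff.mpr fun j hj => sub_ne_zero.mpr (h j (Finset.mem_range.mp hj)).symm

theorem mul_pow_lt_one_of_lt_one (hq0 : 0 < q) (hq1 : q < 1) (ha : a < 1) (j : ℕ) :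
    a * q ^ j < 1 := by
  linarith [mul_pos (sub_pos.mpr ha) (pow_pos hq0 j), pow_le_one₀ (n := j) hq0.le hq1.le]

theorem qPochhammer_pos (hq0 : 0 < q) (hq1 : q < 1) (ha : a < 1) (m : ℕ) :
    0 < qPochhammer a q m :=
  Finset.prod_pos fun j _ => sub_pos.mpr (mul_pow_lt_one_of_lt_one hq0 hq1 ha j)

theorem self_mul_pow_ne_one (hq : |q| < 1) (j : ℕ) : q * q ^ j ≠ 1 := fun h => by
  have hlt : |q ^ (j + 1)| < 1 := by
    rw [abs_pow]
    exact pow_lt_one₀ (abs_nonneg q) hq j.succ_ne_zero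
  rw [pow_succ', h, abs_one] at hlt
  exact lt_irrefl 1 hlt

/-- The polynomial `y ↦ (c y; q)_N`. -/
noncomputable def qPochhammerPoly (c q : ℝ) (N : ℕ) : ℝ[X] :=
  ∏ j ∈ Finset.range N, (1 - C (c * q ^ j) * X)

theorem eval_qPochhammerPoly (c q y : ℝ) (N : ℕ) :
    (qPochhammerPoly c q N).eval y = qPochhammer (c * y) q N := by
  simp only [qPochhammerPoly, qPochhammer, eval_prod, eval_sub, eval_one, eval_mul, eval_C, eval_X,
    mul_right_comm]

theorem natDegree_qPochhammerPoly_le (c q : ℝ) (N : ℕ) :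
    (qPochhammerPoly c q N).natDegree ≤ N := by
  refine (natDegree_prod_le _ _).trans ?_
  refine (Finset.sum_le_card_nsmul _ _ 1 fun j _ => ?_).trans (by simp)
  compute_degree

theorem qPochhammer_mul_pow_div {c : ℝ} (hc : ∀ l : ℕ, c * q ^ l ≠ 1) (N t : ℕ) :
    qPochhammer (c * q ^ N) q t / qPochhammer c q t =
      (qPochhammerPoly c q N).eval (q ^ t) / qPochhammer c q N := by
  rw [eval_qPochhammerPoly, div_eq_div_iff (qPochhammer_ne_zero fun l _ => hc l)
    (qPochhammer_ne_zero fun l _ => hc l), mul_comm, ← qPochhammer_add, mul_comm,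
    ← qPochhammer_add, add_comm]

theorem qPochhammer_div_qPochhammer_mul_self {c : ℝ} (hc : ∀ l : ℕ, c * q ^ l ≠ 1) (t : ℕ) :
    qPochhammer c q t / qPochhammer (c * q) q t = (1 - c) / (1 - c * q ^ t) := by
  have hshift : ∀ j < t, c * q * q ^ j ≠ 1 := fun j _ => by
    rw [mul_assoc, ← pow_succ']
    exact hc (j + 1)
  rw [div_eq_div_iff (qPochhammer_ne_zero hshift) (sub_ne_zero.mpr (hc t).symm),
    ← qPochhammer_succ, add_comm, qPochhammer_add]
  simp [qPochhammer]

end QPochhammer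

section Weight

variable {q α β : ℝ}

theorem littleQJacobiWeight_pos (hq0 : 0 < q) (hq1 : q < 1) (hα0 : 0 < α * q) (hβ1 : β * q < 1)
    (i : ℕ) : 0 < littleQJacobiWeight α β q i :=
  div_pos (mul_pos (qPochhammer_pos hq0 hq1 hβ1 i) (pow_pos hα0 i)) (qPochhammer_pos hq0 hq1 hq1 i)

theorem littleQJacobiWeight_zero (α β q : ℝ) : littleQJacobiWeight α β q 0 = 1 := by
  simp [littleQJacobiWeight, qPochhammer_zero]

theorem littleQJacobiWeight_succ (α β q : ℝ) (i : ℕ) :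
    littleQJacobiWeight α β q (i + 1) =
      (1 - β * q * q ^ i) / (1 - q * q ^ i) * (α * q) * littleQJacobiWeight α β q i := by
  simp only [littleQJacobiWeight, qPochhammer_succ, pow_succ]
  rw [mul_div_mul_comm _ _ (qPochhammer q q i), mul_div_right_comm]
  ring

theorem littleQJacobiWeight_mul_pow (α β q : ℝ) (s i : ℕ) :
    littleQJacobiWeight (α * q ^ s) β q i = (q ^ i) ^ s * littleQJacobiWeight α β q i := by
  rw [littleQJacobiWeight, littleQJacobiWeight, mul_right_comm, mul_pow (α * q), pow_right_comm]
  ring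

theorem summable_littleQJacobiWeight (hq : |q| < 1) (hα : |α * q| < 1) (β : ℝ) :
    Summable (littleQJacobiWeight α β q) := by
  have hratio : Filter.Tendsto (fun i : ℕ => |(1 - β * q * q ^ i) / (1 - q * q ^ i) * (α * q)|)
      Filter.atTop (nhds |α * q|) := by
    have hpow := tendsto_pow_atTop_nhds_zero_of_abs_lt_one hq
    simpa using ((((hpow.const_mul (β * q)).const_sub 1).div
      ((hpow.const_mul q).const_sub 1) (by simp)).mul_const (α * q)).abs
  obtain ⟨r, hαr, hr1⟩ := exists_between hα
  refine summable_of_ratio_norm_eventually_le hr1 ?_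
  filter_upwards [hratio.eventually_le_const hαr] with i hi
  rw [littleQJacobiWeight_succ, norm_mul]
  exact mul_le_mul_of_nonneg_right hi (norm_nonneg _)

/-- The total mass of the little `q`-Jacobi weight. As `w(i; α, β) (q ^ i) ^ s = w(i; α q ^ s, β)`,
its `s`-th moment is `littleQJacobiMass (α * q ^ s) β q`. -/
noncomputable def littleQJacobiMass (α β q : ℝ) : ℝ :=
  ∑' i, littleQJacobiWeight α β q i

theorem littleQJacobiMass_pos (hq0 : 0 < q) (hq1 : q < 1) (hα0 : 0 < α * q) (hα1 : α * q < 1)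
    (hβ1 : β * q < 1) : 0 < littleQJacobiMass α β q := by
  have hw := littleQJacobiWeight_pos hq0 hq1 hα0 hβ1
  exact (summable_littleQJacobiWeight (abs_lt.mpr ⟨by linarith, hq1⟩)
    (abs_lt.mpr ⟨by linarith, hα1⟩) β).tsum_pos (fun i => (hw i).le) 0 (hw 0)

theorem abs_mul_pow_mul_lt_one (hq : |q| < 1) (hα : |α * q| < 1) (s : ℕ) :
    |α * q ^ s * q| < 1 := by
  rw [mul_right_comm, abs_mul, abs_pow]
  exact (mul_le_of_le_one_right (abs_nonneg _) (pow_le_one₀ (abs_nonneg q) hq.le)).trans_lt hα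

theorem littleQJacobiMass_mul_self (hq : |q| < 1) (hα : |α * q| < 1) (β : ℝ) :
    (1 - α * β * q ^ 2) * littleQJacobiMass (α * q) β q =
      (1 - α * q) * littleQJacobiMass α β q := by
  have hw := summable_littleQJacobiWeight hq hα β
  have hw' : Summable (littleQJacobiWeight (α * q) β q) :=
    summable_littleQJacobiWeight hq (by simpa using abs_mul_pow_mul_lt_one hq hα 1) β
  have hterm (i : ℕ) : littleQJacobiWeight α β q (i + 1) - littleQJacobiWeight (α * q) β q (i + 1) =
      α * q * littleQJacobiWeight α β q i -
        α * β * q ^ 2 * littleQJacobiWeight (α * q) β q i := by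
    have hden : 1 - q * q ^ i ≠ 0 := sub_ne_zero.mpr (self_mul_pow_ne_one hq i).symm
    have hshift := littleQJacobiWeight_mul_pow α β q 1
    simp only [pow_one] at hshift
    simp only [hshift, littleQJacobiWeight_succ, pow_succ]
    field_simp
  have hsum := (hw.sub hw').tsum_eq_zero_add
  simp only [hterm, littleQJacobiWeight_zero, sub_self, zero_add] at hsum
  rw [hw.tsum_sub hw', (hw.mul_left _).tsum_sub (hw'.mul_left _), tsum_mul_left,
    tsum_mul_left] at hsum
  simp only [littleQJacobiMass]
  linear_combination -hsum

theorem littleQJacobiMass_mul_pow (hq : |q| < 1) (hα : |α * q| < 1) (β : ℝ) (t : ℕ) :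
    qPochhammer (α * β * q ^ 2) q t * littleQJacobiMass (α * q ^ t) β q =
      qPochhammer (α * q) q t * littleQJacobiMass α β q := by
  induction t with
  | zero => simp [qPochhammer_zero]
  | succ t ih =>
    have hstep := littleQJacobiMass_mul_self hq (abs_mul_pow_mul_lt_one hq hα t) β
    rw [qPochhammer_succ, qPochhammer_succ, pow_succ q t, ← mul_assoc α]
    linear_combination (1 - α * q * q ^ t) * ih + qPochhammer (α * β * q ^ 2) q t * hstep

end Weight

section LagrangeWeights

theorem sum_nodalWeight_mul_eval_eq_zero {F ι : Type*} [Field F] [DecidableEq ι] {s : Finset ι}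
    {v : ι → F} (hvs : Set.InjOn v s) {P : F[X]} (hP : P.natDegree + 1 < s.card) :
    ∑ i ∈ s, Lagrange.nodalWeight s v i * P.eval (v i) = 0 := by
  have hdeg : P.degree < s.card := degree_lt_iff_coeff_zero _ _ |>.mpr fun j hj =>
    coeff_eq_zero_of_natDegree_lt (by lia)
  rw [← coeff_eq_zero_of_natDegree_lt (p := P) (n := s.card - 1) (by lia),
    Lagrange.coeff_eq_sum hvs hdeg]
  refine Finset.sum_congr rfl fun i _ => ?_
  rw [Lagrange.nodalWeight, Finset.prod_inv_distrib, div_eq_mul_inv, mul_comm]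

theorem eval_nodal_mul_sum_nodalWeight_mul_inv_sub_mul_eval {F ι : Type*} [Field F]
    [DecidableEq ι] {s : Finset ι} {v : ι → F} (hvs : Set.InjOn v s) {x : F}
    (hx : ∀ i ∈ s, x ≠ v i) {P : F[X]} (hP : P.degree < s.card) :
    (Lagrange.nodal s v).eval x *
      ∑ i ∈ s, Lagrange.nodalWeight s v i * (x - v i)⁻¹ * P.eval (v i) = P.eval x := by
  rw [← Lagrange.eval_interpolate_not_at_node _ hx, ← Lagrange.eq_interpolate hvs hP]

theorem prod_erase_range_add {M : Type*} [CommMonoid M] (f : ℕ → M) (i d : ℕ) :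
    ∏ j ∈ (Finset.range (i + 1 + d)).erase i, f j =
      (∏ l ∈ Finset.range i, f l) * ∏ l ∈ Finset.range d, f (i + 1 + l) := by
  have hupdate : ∏ j ∈ (Finset.range (i + 1 + d)).erase i, f j =
      ∏ j ∈ Finset.range (i + 1 + d), Function.update f i 1 j := by
    rw [← Finset.prod_erase _ (Function.update_self i 1 f)]
    exact Finset.prod_congr rfl fun j hj =>
      (Function.update_of_ne (Finset.ne_of_mem_erase hj) 1 f).symm
  rw [hupdate, Finset.prod_range_add, Finset.prod_range_succ, Function.update_self, mul_one]
  congr 1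
  · exact Finset.prod_congr rfl fun l hl =>
      Function.update_of_ne (Finset.mem_range.mp hl).ne 1 f
  · exact Finset.prod_congr rfl fun l _ => Function.update_of_ne (by lia) 1 f

variable {q : ℝ}

/-- The Lagrange weight `∏_{j ≠ i} (q ^ i - q ^ j)⁻¹` of the node `q ^ i` among `1, q, …, q ^ n`. -/
noncomputable abbrev geometricNodalWeight (q : ℝ) (n i : ℕ) : ℝ :=
  Lagrange.nodalWeight (Finset.range (n + 1)) (fun j => q ^ j) i

theorem prod_range_pow_sub_pow (q : ℝ) (i : ℕ) :
    ∏ l ∈ Finset.range i, (q ^ i - q ^ l) =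
      (∏ l ∈ Finset.range i, -q ^ l) * qPochhammer q q i := by
  rw [qPochhammer, ← Finset.prod_range_reflect (fun j => 1 - q * q ^ j),
    ← Finset.prod_mul_distrib]
  refine Finset.prod_congr rfl fun l hl => ?_
  obtain ⟨d, rfl⟩ := Nat.exists_eq_add_of_lt (Finset.mem_range.mp hl)
  rw [show l + d + 1 - 1 - l = d by lia]
  ring

theorem prod_range_pow_sub_pow_add (q : ℝ) (i d : ℕ) :
    ∏ l ∈ Finset.range d, (q ^ i - q ^ (i + 1 + l)) = (q ^ i) ^ d * qPochhammer q q d := by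
  nth_rw 2 [← Finset.card_range d]
  rw [qPochhammer, ← Finset.prod_const, ← Finset.prod_mul_distrib]
  exact Finset.prod_congr rfl fun l _ => by ring

theorem qPochhammer_inv_pow_add_mul (hq : q ≠ 0) (i d : ℕ) :
    qPochhammer (q ^ (i + d))⁻¹ q i * q ^ i *
        ((∏ l ∈ Finset.range i, -q ^ l) * ((q ^ i) ^ d * qPochhammer q q d)) =
      qPochhammer q q (i + d) := by
  induction i generalizing d with
  | zero => simp [qPochhammer_zero]
  | succ i ih =>
    have hfactor : 1 - (q ^ (i + (d + 1)))⁻¹ * q ^ i = -(1 - q * q ^ d) / q ^ (d + 1) := by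
      field_simp
      ring
    rw [add_right_comm i 1 d, add_assoc i d 1, ← ih (d + 1), qPochhammer_succ, hfactor,
      qPochhammer_succ q q d, Finset.prod_range_succ]
    field_simp
    ring

theorem qPochhammer_inv_pow_mul_pow_div (hq : |q| < 1) (hq0 : q ≠ 0) {n i : ℕ} (hi : i ≤ n) :
    qPochhammer (q ^ n)⁻¹ q i * q ^ i / qPochhammer q q i =
      qPochhammer q q n * geometricNodalWeight q n i := by
  obtain ⟨d, rfl⟩ := Nat.exists_eq_add_of_le hi
  have hne (m : ℕ) : qPochhammer q q m ≠ 0 :=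
    qPochhammer_ne_zero fun j _ => self_mul_pow_ne_one hq j
  have hpow (l : ℕ) : q ^ l ≠ 0 := pow_ne_zero l hq0
  have hsign : ∏ l ∈ Finset.range i, -q ^ l ≠ 0 :=
    Finset.prod_ne_zero_iff.mpr fun l _ => neg_ne_zero.mpr (hpow l)
  rw [geometricNodalWeight, Lagrange.nodalWeight, Finset.prod_inv_distrib, add_right_comm,
    prod_erase_range_add, prod_range_pow_sub_pow, prod_range_pow_sub_pow_add,
    ← qPochhammer_inv_pow_add_mul hq0, ← div_eq_mul_inv, div_eq_div_iff (hne i)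
      (mul_ne_zero (mul_ne_zero hsign (hne i)) (mul_ne_zero (pow_ne_zero d (hpow i)) (hne d)))]
  ring

end LagrangeWeights

section Moments

variable {q a b : ℝ} {k m n : ℕ}

/-- The common factor `(-1)ⁿ q^(n choose 2) (αq; q)_n (q; q)_n / (αβq^(n+1); q)_n` of the
coefficients of the little `q`-Jacobi polynomial, when these are expressed through the Lagrange
weights of `1, q, …, qⁿ`. -/
noncomputable def littleQJacobiScale (n : ℕ) (α β q : ℝ) : ℝ :=
  (-1) ^ n * q ^ n.choose 2 *
    (qPochhammer (α * q) q n / qPochhammer (α * β * q ^ (n + 1)) q n) * qPochhammer q q n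

theorem littleQJacobi_eq_sum (hq : |q| < 1) (hq0 : q ≠ 0) (n : ℕ) (a b : ℝ) :
    littleQJacobi n a b q = ∑ t ∈ Finset.range (n + 1),
      C (littleQJacobiScale n a b q * (geometricNodalWeight q n t *
        (qPochhammer (a * b * q ^ (n + 1)) q t / qPochhammer (a * q) q t))) * X ^ t := by
  rw [littleQJacobi, Finset.mul_sum]
  refine Finset.sum_congr rfl fun t ht => ?_
  have hweight := qPochhammer_inv_pow_mul_pow_div hq hq0 (Finset.mem_range_succ_iff.mp ht)
  rw [mul_pow, ← C_pow, ← mul_assoc, ← mul_assoc, ← C_mul, ← C_mul, littleQJacobiScale]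
  congr 2
  linear_combination (-1) ^ n * q ^ n.choose 2 *
    (qPochhammer (a * q) q n / qPochhammer (a * b * q ^ (n + 1)) q n) *
    (qPochhammer (a * b * q ^ (n + 1)) q t / qPochhammer (a * q) q t) * hweight

theorem littleQJacobiScale_ne_zero (hq0 : 0 < q) (hq1 : q < 1)
    (ha : ∀ l : ℕ, a * q * q ^ l ≠ 1) (hab : a * b * q ^ (n + 1) < 1) :
    littleQJacobiScale n a b q ≠ 0 :=
  mul_ne_zero (mul_ne_zero (mul_ne_zero (pow_ne_zero n (neg_ne_zero.mpr one_ne_zero))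
    (pow_ne_zero _ hq0.ne')) (div_ne_zero (qPochhammer_ne_zero fun l _ => ha l)
      (qPochhammer_pos hq0 hq1 hab n).ne')) (qPochhammer_pos hq0 hq1 hq1 n).ne'

theorem injOn_pow_of_lt_one (hq0 : 0 < q) (hq1 : q < 1) (s : Set ℕ) :
    Set.InjOn (fun i : ℕ => q ^ i) s :=
  (pow_right_injective₀ hq0 hq1.ne).injOn

theorem degree_littleQJacobi (hq0 : 0 < q) (hq1 : q < 1) (ha : ∀ l : ℕ, a * q * q ^ l ≠ 1)
    (hab : a * b * q ^ (n + 1) < 1) : (littleQJacobi n a b q).degree = n := by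
  rw [littleQJacobi_eq_sum (abs_lt.mpr ⟨by linarith, hq1⟩) hq0.ne']
  refine degree_eq_of_le_of_coeff_ne_zero ((degree_sum_le _ _).trans
    (Finset.sup_le fun t ht => ?_)) ?_
  · exact (degree_C_mul_X_pow_le t _).trans
      (Nat.cast_le.mpr (Finset.mem_range_succ_iff.mp ht))
  · simp only [finsetSum_coeff, coeff_C_mul_X_pow, Finset.sum_ite_eq, Finset.mem_range,
      lt_add_one, if_true]
    exact mul_ne_zero (littleQJacobiScale_ne_zero hq0 hq1 ha hab) (mul_ne_zero
      (Lagrange.nodalWeight_ne_zero (injOn_pow_of_lt_one hq0 hq1 _) (Finset.self_mem_range_succ n))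
      (div_ne_zero (qPochhammer_pos hq0 hq1 hab n).ne' (qPochhammer_ne_zero fun l _ => ha l)))

theorem hasSum_littleQJacobi_mul_weight {α : ℝ} (hq : |q| < 1) (hq0 : q ≠ 0) (hα : |α * q| < 1)
    (n : ℕ) (a b β : ℝ) :
    HasSum (fun i => (littleQJacobi n a b q).eval (q ^ i) * littleQJacobiWeight α β q i)
      (littleQJacobiScale n a b q * ∑ t ∈ Finset.range (n + 1), geometricNodalWeight q n t *
        (qPochhammer (a * b * q ^ (n + 1)) q t / qPochhammer (a * q) q t) *
          littleQJacobiMass (α * q ^ t) β q) := by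
  simp only [littleQJacobi_eq_sum hq hq0, eval_finsetSum, eval_mul, eval_C, eval_pow, eval_X,
    Finset.mul_sum, Finset.sum_mul]
  refine hasSum_sum fun t _ => ?_
  have hmoment : HasSum (littleQJacobiWeight (α * q ^ t) β q) (littleQJacobiMass (α * q ^ t) β q) :=
    (summable_littleQJacobiWeight hq (abs_mul_pow_mul_lt_one hq hα t) β).hasSum
  simp only [mul_assoc _ ((q ^ _) ^ t), ← littleQJacobiWeight_mul_pow, ← mul_assoc]
  simpa only [mul_assoc] using hmoment.mul_left (littleQJacobiScale n a b q *
    (geometricNodalWeight q n t *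
      (qPochhammer (a * b * q ^ (n + 1)) q t / qPochhammer (a * q) q t)))

theorem mul_mul_sq_lt_one {α β : ℝ} (hα0 : 0 < α * q) (hα1 : α * q < 1) (hβ1 : β * q < 1) :
    α * β * q ^ 2 < 1 := by
  calc α * β * q ^ 2 = α * q * (β * q) := by ring
    _ ≤ α * q * 1 := mul_le_mul_of_nonneg_left hβ1.le hα0.le
    _ < 1 := by rwa [mul_one]

theorem hasSum_littleQJacobi_mul_shifted_weight (hq0 : 0 < q) (hq1 : q < 1)
    (hα0 : 0 < a * q ^ k * q) (hα1 : a * q ^ k * q < 1) (hβ1 : b * q ^ m * q < 1)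
    (ha : ∀ l : ℕ, a * q * q ^ l ≠ 1) :
    HasSum (fun i => (littleQJacobi n a b q).eval (q ^ i) *
        littleQJacobiWeight (a * q ^ k) (b * q ^ m) q i)
      (littleQJacobiScale n a b q * (littleQJacobiMass (a * q ^ k) (b * q ^ m) q /
        qPochhammer (a * q) q k * ∑ t ∈ Finset.range (n + 1), geometricNodalWeight q n t *
          ((qPochhammerPoly (a * q) q k).eval (q ^ t) *
            (qPochhammer (a * b * q ^ (n + 1)) q t /
              qPochhammer (a * b * q ^ (k + m + 2)) q t)))) := by
  have hq : |q| < 1 := abs_lt.mpr ⟨by linarith, hq1⟩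
  have hα : |a * q ^ k * q| < 1 := abs_lt.mpr ⟨by linarith, hα1⟩
  have hc : a * q ^ k * (b * q ^ m) * q ^ 2 = a * b * q ^ (k + m + 2) := by ring
  have hmass (t : ℕ) : littleQJacobiMass (a * q ^ k * q ^ t) (b * q ^ m) q =
      qPochhammer (a * q * q ^ k) q t / qPochhammer (a * b * q ^ (k + m + 2)) q t *
        littleQJacobiMass (a * q ^ k) (b * q ^ m) q := by
    have hpos := qPochhammer_pos hq0 hq1 (mul_mul_sq_lt_one hα0 hα1 hβ1) t
    rw [div_mul_eq_mul_div, eq_div_iff (hc ▸ hpos.ne'), mul_comm, ← hc, mul_right_comm a q,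
      littleQJacobiMass_mul_pow hq hα]
  convert hasSum_littleQJacobi_mul_weight hq hq0.ne' hα n a b (b * q ^ m) using 2
  rw [Finset.mul_sum]
  refine Finset.sum_congr rfl fun t _ => ?_
  have hshift := qPochhammer_mul_pow_div ha k t
  rw [hmass]
  linear_combination -(geometricNodalWeight q n t * littleQJacobiMass (a * q ^ k) (b * q ^ m) q *
    (qPochhammer (a * b * q ^ (n + 1)) q t / qPochhammer (a * b * q ^ (k + m + 2)) q t)) * hshift

theorem sum_geometricNodalWeight_eq_zero {c : ℝ} {P : ℝ[X]} {N : ℕ} (hq0 : 0 < q) (hq1 : q < 1)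
    (hc : ∀ l : ℕ, c * q ^ l ≠ 1) (hP : P.natDegree + N < n) :
    ∑ t ∈ Finset.range (n + 1), geometricNodalWeight q n t *
      (P.eval (q ^ t) * (qPochhammer (c * q ^ N) q t / qPochhammer c q t)) = 0 := by
  have hdeg : (P * qPochhammerPoly c q N).natDegree + 1 < (Finset.range (n + 1)).card := by
    have := natDegree_mul_le (p := P) (q := qPochhammerPoly c q N)
    have := natDegree_qPochhammerPoly_le c q N
    rw [Finset.card_range]
    lia
  have hsum := sum_nodalWeight_mul_eval_eq_zero (injOn_pow_of_lt_one hq0 hq1 _) hdeg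
  simp only [qPochhammer_mul_pow_div hc, ← mul_div_assoc, ← Finset.sum_div, ← eval_mul, hsum,
    zero_div]

theorem sum_geometricNodalWeight_ne_zero {c : ℝ} {P : ℝ[X]} (hq0 : 0 < q) (hq1 : q < 1)
    (hc0 : c ≠ 0) (hc : ∀ l : ℕ, c * q ^ l ≠ 1) (hP : P.natDegree ≤ n) (hPc : P.eval c⁻¹ ≠ 0) :
    ∑ t ∈ Finset.range (n + 1), geometricNodalWeight q n t *
      (P.eval (q ^ t) * (qPochhammer c q t / qPochhammer (c * q) q t)) ≠ 0 := by
  have hnode : ∀ t ∈ Finset.range (n + 1), c⁻¹ ≠ q ^ t := fun t _ h =>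
    hc t (by rw [← h, mul_inv_cancel₀ hc0])
  have hdeg : P.degree < (Finset.range (n + 1)).card := by
    rw [Finset.card_range]
    exact degree_le_natDegree.trans_lt (by exact_mod_cast Nat.lt_succ_of_le hP)
  have hsum := eval_nodal_mul_sum_nodalWeight_mul_inv_sub_mul_eval
    (injOn_pow_of_lt_one hq0 hq1 _) hnode hdeg
  have hterm (t : ℕ) : (1 - c) / (1 - c * q ^ t) = (1 - c) / c * (c⁻¹ - q ^ t)⁻¹ := by
    rw [← div_eq_mul_inv, div_div, mul_sub, mul_inv_cancel₀ hc0]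
  have hfactor : (1 - c) / c ≠ 0 :=
    div_ne_zero (sub_ne_zero.mpr (by simpa using (hc 0).symm)) hc0
  convert mul_ne_zero hfactor (right_ne_zero_of_mul (hsum.trans_ne hPc)) using 1
  rw [Finset.mul_sum]
  refine Finset.sum_congr rfl fun t _ => ?_
  rw [qPochhammer_div_qPochhammer_mul_self hc, hterm]
  ring

theorem hasSum_littleQJacobi_mul_shifted_weight_zero (hq0 : 0 < q) (hq1 : q < 1)
    (hα0 : 0 < a * q ^ k * q) (hα1 : a * q ^ k * q < 1) (hβ1 : b * q ^ m * q < 1)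
    (ha : ∀ l : ℕ, a * q * q ^ l ≠ 1) (hn : k + m < n) :
    HasSum (fun i => (littleQJacobi n a b q).eval (q ^ i) *
      littleQJacobiWeight (a * q ^ k) (b * q ^ m) q i) 0 := by
  have hc (l : ℕ) : a * b * q ^ (k + m + 2) * q ^ l ≠ 1 := by
    convert (mul_pow_lt_one_of_lt_one hq0 hq1 (mul_mul_sq_lt_one hα0 hα1 hβ1) l).ne using 1
    ring
  obtain ⟨N, rfl⟩ := Nat.exists_eq_add_of_lt hn
  have hexp : a * b * q ^ (k + m + N + 1 + 1) = a * b * q ^ (k + m + 2) * q ^ N := by ring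
  have hdeg : (qPochhammerPoly (a * q) q k).natDegree + N < k + m + N + 1 := by
    have := natDegree_qPochhammerPoly_le (a * q) q k
    lia
  have hsum := hasSum_littleQJacobi_mul_shifted_weight (n := k + m + N + 1)
    hq0 hq1 hα0 hα1 hβ1 ha
  rwa [hexp, sum_geometricNodalWeight_eq_zero hq0 hq1 hc hdeg, mul_zero, mul_zero] at hsum

theorem eval_qPochhammerPoly_inv_ne_zero {c e : ℝ} (hc0 : c ≠ 0)
    (h : ∀ l < k, e * q ^ l ≠ c) : (qPochhammerPoly e q k).eval c⁻¹ ≠ 0 := by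
  rw [eval_qPochhammerPoly]
  refine qPochhammer_ne_zero fun l hl => ?_
  rw [mul_right_comm, ← div_eq_mul_inv, ne_eq, div_eq_one_iff_eq hc0]
  exact h l hl

theorem exists_hasSum_littleQJacobi_mul_shifted_weight_ne_zero (hq0 : 0 < q) (hq1 : q < 1)
    (hα0 : 0 < a * q ^ k) (hα1 : a * q ^ k < 1) (hb0 : b ≠ 0) (hβ1 : b * q ^ m * q < 1)
    (ha : ∀ l : ℕ, a * q * q ^ l ≠ 1) :
    ∃ s : ℝ, s ≠ 0 ∧ HasSum (fun i => (littleQJacobi (k + m) a b q).eval (q ^ i) *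
      littleQJacobiWeight (a * q ^ k) (b * q ^ m) q i) s := by
  have hαq0 : 0 < a * q ^ k * q := mul_pos hα0 hq0
  have hαq1 : a * q ^ k * q < 1 := by simpa using mul_pow_lt_one_of_lt_one hq0 hq1 hα1 1
  have ha0 : a ≠ 0 := left_ne_zero_of_mul hα0.ne'
  have hc0 : a * b * q ^ (k + m + 1) ≠ 0 := mul_ne_zero (mul_ne_zero ha0 hb0) (by positivity)
  have hc1 : a * b * q ^ (k + m + 1) < 1 := by
    calc a * b * q ^ (k + m + 1) = a * q ^ k * (b * q ^ m * q) := by ring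
      _ < a * q ^ k * 1 := mul_lt_mul_of_pos_left hβ1 hα0
      _ < 1 := by rwa [mul_one]
  have hpole : (qPochhammerPoly (a * q) q k).eval (a * b * q ^ (k + m + 1))⁻¹ ≠ 0 := by
    refine eval_qPochhammerPoly_inv_ne_zero hc0 fun l hl h => ?_
    obtain ⟨d, rfl⟩ := Nat.exists_eq_add_of_lt hl
    refine (mul_pow_lt_one_of_lt_one hq0 hq1 hβ1 d).ne (mul_left_cancel₀
      (mul_ne_zero (mul_ne_zero ha0 hq0.ne') (pow_ne_zero l hq0.ne')) ?_)
    linear_combination -h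
  have hne := sum_geometricNodalWeight_ne_zero hq0 hq1 hc0
    (fun l => (mul_pow_lt_one_of_lt_one hq0 hq1 hc1 l).ne)
    ((natDegree_qPochhammerPoly_le (a * q) q k).trans (Nat.le_add_right k m)) hpole
  rw [mul_assoc (a * b), ← pow_succ] at hne
  exact ⟨_, mul_ne_zero (littleQJacobiScale_ne_zero hq0 hq1 ha hc1) (mul_ne_zero
    (div_ne_zero (littleQJacobiMass_pos hq0 hq1 hαq0 hαq1 hβ1).ne'
      (qPochhammer_ne_zero fun l _ => ha l)) hne),
    hasSum_littleQJacobi_mul_shifted_weight hq0 hq1 hαq0 hαq1 hβ1 ha⟩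

end Moments

section Zeros

/-- The real polynomial `P` does not change sign on `s`, zeros being allowed. -/
def HasConstantSignOn (P : ℝ[X]) (s : Set ℝ) : Prop :=
  (∀ x ∈ s, 0 ≤ P.eval x) ∨ ∀ x ∈ s, P.eval x ≤ 0

namespace HasConstantSignOn

variable {P : ℝ[X]} {s : Set ℝ}

theorem of_forall_ne_zero (hs : IsPreconnected s) (hP : ∀ x ∈ s, P.eval x ≠ 0) :
    HasConstantSignOn P s := by
  by_contra h
  simp only [HasConstantSignOn, not_or, not_forall, not_le] at h
  obtain ⟨⟨x, hx, hx0⟩, y, hy, hy0⟩ := h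
  obtain ⟨z, hz, hz0⟩ := hs.intermediate_value hx hy P.continuousOn ⟨hx0.le, hy0.le⟩
  exact hP z hz hz0

theorem sq_mul (h : HasConstantSignOn P s) (R : ℝ[X]) : HasConstantSignOn (R ^ 2 * P) s := by
  simp only [HasConstantSignOn, eval_mul, eval_pow]
  exact h.imp (fun h x hx => mul_nonneg (sq_nonneg _) (h x hx))
    fun h x hx => mul_nonpos_of_nonneg_of_nonpos (sq_nonneg _) (h x hx)

theorem closure (h : HasConstantSignOn P s) : HasConstantSignOn P (closure s) :=
  h.imp (fun h => closure_minimal h (isClosed_le continuous_const P.continuous))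
    fun h => closure_minimal h (isClosed_le P.continuous continuous_const)

end HasConstantSignOn

/-- The points of `S` are the zeros of odd multiplicity. -/
theorem exists_hasConstantSignOn_mul_nodal {s : Set ℝ} (hs : IsPreconnected s) (Q : ℝ[X]) :
    ∃ S : Finset ℝ, (∀ y ∈ S, y ∈ s ∧ Q.eval y = 0) ∧
      HasConstantSignOn (Q * Lagrange.nodal S id) s := by
  induction hd : Q.natDegree generalizing Q with
  | zero =>
    rw [eq_C_of_natDegree_eq_zero hd]
    exact ⟨∅, by simp, (le_total 0 (Q.coeff 0)).imp (fun h x _ => by simpa using h)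
      fun h x _ => by simpa using h⟩
  | succ d ih =>
    by_cases! hroot : ∀ x ∈ s, Q.eval x ≠ 0
    · exact ⟨∅, by simp, by simpa using HasConstantSignOn.of_forall_ne_zero hs hroot⟩
    obtain ⟨r, hr, hr0⟩ := hroot
    obtain ⟨R, rfl⟩ := dvd_iff_isRoot.mpr hr0
    have hR : R ≠ 0 := by
      rintro rfl
      simp at hd
    rw [natDegree_mul (X_sub_C_ne_zero r) hR, natDegree_X_sub_C] at hd
    obtain ⟨S, hS, hsign⟩ := ih R (by lia)
    have hzero : ∀ y ∈ S, y ∈ s ∧ ((X - C r) * R).eval y = 0 := fun y hy =>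
      ⟨(hS y hy).1, by rw [eval_mul, (hS y hy).2, mul_zero]⟩
    by_cases hrS : r ∈ S
    · refine ⟨S.erase r, fun y hy => hzero y (Finset.mem_of_mem_erase hy), ?_⟩
      have hnodal : (X - C r) * Lagrange.nodal (S.erase r) id = Lagrange.nodal S id :=
        (Lagrange.nodal_eq_mul_nodal_erase (v := id) hrS).symm
      rwa [mul_comm (X - C r), mul_assoc, hnodal]
    · refine ⟨insert r S, Finset.forall_mem_insert .. |>.mpr ⟨⟨hr, hr0⟩, hzero⟩, ?_⟩
      rw [Lagrange.nodal_insert_eq_nodal hrS, id_eq, mul_mul_mul_comm, ← sq]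
      exact hsign.sq_mul (X - C r)

variable {x w : ℕ → ℝ} {P Q : ℝ[X]} {r : ℕ}

theorem hasSum_eval_mul_of_natDegree_lt {f : ℕ → ℝ} (hP : P.natDegree < r)
    (hmoment : ∀ j < r, HasSum (fun i => x i ^ j * f i) 0) :
    HasSum (fun i => P.eval (x i) * f i) 0 := by
  have hsum := hasSum_sum (s := Finset.range r) fun j hj =>
    (hmoment j (Finset.mem_range.mp hj)).mul_left (P.coeff j)
  simpa only [eval_eq_sum_range' hP, Finset.sum_mul, mul_assoc, mul_zero,
    Finset.sum_const_zero] using hsum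

theorem eq_zero_of_hasSum_eval_mul_of_nonneg (hx : Function.Injective x) (hw : ∀ i, 0 < w i)
    (hP : ∀ i, 0 ≤ P.eval (x i)) (hsum : HasSum (fun i => P.eval (x i) * w i) 0) : P = 0 := by
  have hterm := (hasSum_zero_iff_of_nonneg fun i => mul_nonneg (hP i) (hw i).le).mp hsum
  have hroot (i : ℕ) : P.IsRoot (x i) :=
    (mul_eq_zero.mp (congrFun hterm i)).resolve_right (hw i).ne'
  exact eq_zero_of_infinite_isRoot P
    ((Set.infinite_range_of_injective hx).mono (Set.range_subset_iff.mpr hroot))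

theorem HasConstantSignOn.eq_zero_of_hasSum {s : Set ℝ} (h : HasConstantSignOn P s)
    (hxs : ∀ i, x i ∈ s) (hx : Function.Injective x) (hw : ∀ i, 0 < w i)
    (hsum : HasSum (fun i => P.eval (x i) * w i) 0) : P = 0 := by
  rcases h with hnonneg | hnonpos
  · exact eq_zero_of_hasSum_eval_mul_of_nonneg hx hw (fun i => hnonneg _ (hxs i)) hsum
  · refine neg_eq_zero.mp (eq_zero_of_hasSum_eval_mul_of_nonneg hx hw (fun i => ?_) ?_)
    · simpa using hnonpos _ (hxs i)
    · simpa using hsum.neg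

/-- With fewer than `n - k` sign changes, `Q` would be orthogonal to the product of the linear
factors at its sign changes, although its product with that polynomial has constant sign. -/
theorem IsDiscreteQuasiOrthogonal.hasAtLeastZerosIn {c d : ℝ} {n k : ℕ}
    (h : IsDiscreteQuasiOrthogonal c d x w n k Q) (hx : Function.Injective x) :
    HasAtLeastZerosIn c d (n - k) Q := by
  obtain ⟨S, hS, hsign⟩ :=
    exists_hasConstantSignOn_mul_nodal (isPreconnected_Ioo (a := c) (b := d)) Q
  refine ⟨S, ?_, hS⟩
  by_contra! hcard
  have hcd : c ≠ d := by
    rintro rfl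
    have hconst (i : ℕ) : x i = c := by simpa using h.mem_Icc i
    exact zero_ne_one (hx ((hconst 0).trans (hconst 1).symm))
  have hsum : HasSum (fun i => (Q * Lagrange.nodal S id).eval (x i) * w i) 0 := by
    have := hasSum_eval_mul_of_natDegree_lt (P := Lagrange.nodal S id) (r := n - k)
      (f := fun i => Q.eval (x i) * w i) (by rwa [Lagrange.natDegree_nodal]) fun j hj => by
        simpa only [mul_assoc] using h.moment_eq_zero j (by lia)
    simpa only [eval_mul, mul_left_comm, mul_assoc] using this
  have hQ : Q ≠ 0 := by
    rintro rfl
    simpa using h.degree_eq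
  refine mul_ne_zero hQ Lagrange.nodal_ne_zero
    (hsign.closure.eq_zero_of_hasSum (fun i => ?_) hx h.weight_pos hsum)
  rw [closure_Ioo hcd]
  exact h.mem_Icc i

end Zeros

theorem mul_self_mul_pow_ne_one {q a : ℝ} {k : ℕ} (hq0 : 0 < q) (hq1 : q < 1)
    (hα1 : a * q ^ k * q < 1) (hα : ∀ i < k, a * q ^ k ≠ q ^ i) (l : ℕ) :
    a * q * q ^ l ≠ 1 := by
  intro h
  rcases lt_or_ge l k with hlk | hkl
  · obtain ⟨i, rfl⟩ := Nat.exists_eq_add_of_lt hlk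
    exact hα i (by lia) (by linear_combination q ^ i * h)
  · obtain ⟨j, rfl⟩ := Nat.exists_eq_add_of_le hkl
    exact (mul_pow_lt_one_of_lt_one hq0 hq1 hα1 j).ne (by linear_combination h)

theorem isDiscreteQuasiOrthogonal_littleQJacobi {q a b : ℝ} {k m n : ℕ} (hq0 : 0 < q)
    (hq1 : q < 1) (hα0 : 0 < a * q ^ k * q) (hα1 : a * q ^ k * q < 1) (hb0 : b ≠ 0)
    (hβ1 : b * q ^ m * q < 1) (ha : ∀ l : ℕ, a * q * q ^ l ≠ 1) (hn : k + m + 1 ≤ n) :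
    IsDiscreteQuasiOrthogonal 0 1 (fun i => q ^ i)
      (littleQJacobiWeight (a * q ^ k) (b * q ^ m) q) n (k + m) (littleQJacobi n a b q) := by
  have hmoment (j i : ℕ) : (q ^ i) ^ j * (littleQJacobi n a b q).eval (q ^ i) *
      littleQJacobiWeight (a * q ^ k) (b * q ^ m) q i = (littleQJacobi n a b q).eval (q ^ i) *
        littleQJacobiWeight (a * q ^ (k + j)) (b * q ^ m) q i := by
    rw [pow_add, ← mul_assoc a, littleQJacobiWeight_mul_pow (a * q ^ k)]
    ring
  have hshift (j : ℕ) : a * q ^ (k + j) * q = a * q ^ k * q * q ^ j := by ring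
  have hαj0 (j : ℕ) : 0 < a * q ^ (k + j) * q := hshift j ▸ mul_pos hα0 (pow_pos hq0 j)
  have hαj1 (j : ℕ) : a * q ^ (k + j) * q < 1 :=
    hshift j ▸ mul_pow_lt_one_of_lt_one hq0 hq1 hα1 j
  obtain ⟨j, rfl⟩ : ∃ j, n = k + (j + 1) + m := ⟨n - (k + m + 1), by lia⟩
  refine ⟨fun i => ⟨(pow_pos hq0 i).le, pow_le_one₀ hq0.le hq1.le⟩,
    littleQJacobiWeight_pos hq0 hq1 hα0 hβ1, by lia, ?_, fun s hs => ?_, ?_⟩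
  · refine degree_littleQJacobi hq0 hq1 ha ?_
    convert mul_pow_lt_one_of_lt_one hq0 hq1 (mul_mul_sq_lt_one hα0 hα1 hβ1) j using 1
    ring
  · simp only [hmoment]
    exact hasSum_littleQJacobi_mul_shifted_weight_zero hq0 hq1 (hαj0 s) (hαj1 s) hβ1 ha (by lia)
  · have hlast : a * q ^ (k + (j + 1)) = a * q ^ (k + j) * q := by ring
    rw [show k + (j + 1) + m - (k + m) = j + 1 by lia]
    simp only [hmoment]
    exact exists_hasSum_littleQJacobi_mul_shifted_weight_ne_zero hq0 hq1 (hlast ▸ hαj0 j)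
      (hlast ▸ hαj1 j) hb0 hβ1 ha

theorem theorem2p9_general {q α β : ℝ} {k m n : ℕ} (hq0 : 0 < q) (hq1 : q < 1)
    (hα0 : 0 < α * q) (hα1 : α * q < 1) (hβ0 : β ≠ 0) (hβ1 : β * q < 1)
    (hα : ∀ i < k, α ≠ q ^ i) (hn : k + m + 1 ≤ n) :
    IsDiscreteQuasiOrthogonal 0 1 (fun i => q ^ i) (littleQJacobiWeight α β q) n (k + m)
        (littleQJacobi n (α / q ^ k) (β / q ^ m) q) ∧
      HasAtLeastZerosIn 0 1 (n - (k + m)) (littleQJacobi n (α / q ^ k) (β / q ^ m) q) := by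
  obtain ⟨a, rfl⟩ : ∃ a, α = a * q ^ k := ⟨α / q ^ k, by field_simp⟩
  obtain ⟨b, rfl⟩ : ∃ b, β = b * q ^ m := ⟨β / q ^ m, by field_simp⟩
  rw [mul_div_cancel_right₀ a (pow_ne_zero k hq0.ne'),
    mul_div_cancel_right₀ b (pow_ne_zero m hq0.ne')]
  have hquasi := isDiscreteQuasiOrthogonal_littleQJacobi hq0 hq1 hα0 hα1 (left_ne_zero_of_mul hβ0)
    hβ1 (mul_self_mul_pow_ne_one hq0 hq1 hα1 hα) hn
  exact ⟨hquasi, hquasi.hasAtLeastZerosIn (pow_right_injective₀ hq0 hq1.ne)⟩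

theorem theorem2p9 (q α β : ℝ) (hq0 : 0 < q) (hq1 : q < 1)
    (hα0 : 0 < α * q) (hα1 : α * q < 1) (hβ0 : 0 < β * q) (hβ1 : β * q < 1) :
    (1 < α → ∀ k n : ℕ, k + 1 ≤ n →
      IsDiscreteQuasiOrthogonal 0 1 (fun i => q ^ i) (littleQJacobiWeight α β q) n k
          (littleQJacobi n (α / q ^ k) β q) ∧
        HasAtLeastZerosIn 0 1 (n - k) (littleQJacobi n (α / q ^ k) β q)) ∧
    (1 < β → ∀ m n : ℕ, m + 1 ≤ n →
      IsDiscreteQuasiOrthogonal 0 1 (fun i => q ^ i) (littleQJacobiWeight α β q) n m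
          (littleQJacobi n α (β / q ^ m) q) ∧
        HasAtLeastZerosIn 0 1 (n - m) (littleQJacobi n α (β / q ^ m) q)) ∧
    (1 < α → 1 < β → ∀ k m n : ℕ, k + m + 1 ≤ n →
      IsDiscreteQuasiOrthogonal 0 1 (fun i => q ^ i) (littleQJacobiWeight α β q) n (k + m)
          (littleQJacobi n (α / q ^ k) (β / q ^ m) q) ∧
        HasAtLeastZerosIn 0 1 (n - (k + m)) (littleQJacobi n (α / q ^ k) (β / q ^ m) q)) := by
  have hβ : β ≠ 0 := left_ne_zero_of_mul hβ0.ne'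
  have hα : 1 < α → ∀ k, ∀ i < k, α ≠ q ^ i := fun h _ _ _ =>
    ((pow_le_one₀ hq0.le hq1.le).trans_lt h).ne'
  refine ⟨fun h k n hn => ?_, fun _ m n hn => ?_, fun h _ k m n hn =>
    theorem2p9_general hq0 hq1 hα0 hα1 hβ hβ1 (hα h k) hn⟩
  · simpa using theorem2p9_general (m := 0) hq0 hq1 hα0 hα1 hβ hβ1 (hα h k) hn
  · simpa using theorem2p9_general (k := 0) (m := m) (n := n) hq0 hq1 hα0 hα1 hβ hβ1 (by simp)
      (by simpa using hn)
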